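/- Let $1\le k<n$, let $v_1,\dots,v_n$ be a basis of $\mathbb{C}^n$, and let $\mathbb{S}_{(2,1^{k-1})}\mathbb{C}^n\subset \bigwedge^k\mathbb{C}^n\otimes\mathbb{C}^n$ be the Schur module of the partition $(2,1^{k-1})$, i.e. the image of the Young symmetrizer of the standard tableau of this shape whose first column is filled with $1,\dots,k$ and whose remaining box contains $k+1$. Let $\mathbb{F}=\mathbb{F}(1,k;\mathbb{C}^n)\subset\mathbb{P}(\mathbb{S}_{(2,1^{k-1})}\mathbb{C}^n)$ be the flag variety, in which a flag $V_1\subset V_2\subset\mathbb{C}^n$ with $\dim V_1=1$, $\dim V_2=k$ corresponds to the point $[u_1\wedge\dots\wedge u_k\otimes u_1]$, where $u_1,\dots,u_k$ is any basis of $V_2$ with $V_1=\langle u_1\rangle$. Let $p=[v_1\wedge\dots\wedge v_k\otimes v_1]$. Then $p\in\mathbb{F}$, and the affine cone $\widehat{T_p\mathbb{F}}$ over the embedded tangent space to $\mathbb{F}$ at $p$ (the space of all $w\in\mathbb{S}_{(2,1^{k-1})}\mathbb{C}^n$ annihilated by the differential, at a representative of $p$, of every homogeneous polynomial on $\mathbb{S}_{(2,1^{k-1})}\mathbb{C}^n$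 that vanishes on $\mathbb{F}$) is the linear span of 1. the tensor $v_1\wedge\dots\wedge v_k\otimes v_1$; 2. the tensors $v_1\wedge\dots\wedge v_{i-1}\wedge v_h\wedge v_{i+1}\wedge\dots\wedge v_k\otimes v_1$, for $i\in\{2,\dots,k\}$ and $h\in\{1,\dots,n\}$; 3. the tensors $v_1\wedge\dots\wedge v_k\otimes v_h+v_h\wedge v_2\wedge\dots\wedge v_k\otimes v_1$, for $h\in\{1,\dots,n\}$. In particular all these tensors lie in $\mathbb{S}_{(2,1^{k-1})}\mathbb{C}^n$. -/

import Mathlib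

open scoped TensorProduct
open scoped LinearAlgebra.Projectivization

noncomputable section

namespace SchurFlag

section Projective

variable {W : Type*} [AddCommGroup W] [Module ℂ W]

/-- The affine cone in `W` over a subset `X` of the projective space `ℙ(W)`. -/
def affineCone (X : Set (ℙ ℂ W)) : Set W :=
  {w | ∀ hw : w ≠ 0, Projectivization.mk ℂ w hw ∈ X}

/-- The value at `w` of a polynomial function on `W`, written as a polynomial in the linear
forms on `W`. -/
def evalAt (w : W) (f : MvPolynomial (Module.Dual ℂ W) ℂ) : ℂ :=
  MvPolynomial.eval (fun φ => φ w) f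

/-- The derivative at `x` in the direction `w` of a polynomial function on `W`: the value at `x`
of the image of `f` under the derivation that sends each linear form `φ` to the constant `φ w`. -/
def dirDeriv (x w : W) (f : MvPolynomial (Module.Dual ℂ W) ℂ) : ℂ :=
  evalAt x (MvPolynomial.mkDerivation ℂ (fun φ : Module.Dual ℂ W => MvPolynomial.C (φ w)) f)

/-- The affine cone over the embedded (Zariski) tangent space `T_p X` of `X ⊆ ℙ(W)` at `p`: the
linear subspace of those `w` at which the differential at (a representative of) `p` of every
homogeneous polynomial vanishing on `X` vanishes. -/
def tangentCone (X : Set (ℙ ℂ W)) (p : ℙ ℂ W) : Submodule ℂ W where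
  carrier := {w | ∀ (d : ℕ) (f : MvPolynomial (Module.Dual ℂ W) ℂ), f.IsHomogeneous d →
    (∀ y ∈ affineCone X, evalAt y f = 0) → dirDeriv p.rep w f = 0}
  zero_mem' := by
    intro d f _ _
    have h : MvPolynomial.mkDerivation ℂ (fun φ : Module.Dual ℂ W =>
        (MvPolynomial.C (φ (0 : W)) : MvPolynomial (Module.Dual ℂ W) ℂ)) = 0 := by
      apply MvPolynomial.derivation_ext
      intro φ
      simp [MvPolynomial.mkDerivation_X]
    simp only [dirDeriv, evalAt]
    rw [h, Derivation.zero_apply, map_zero]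
  add_mem' := by
    intro a b ha hb d f hf hX
    have h : MvPolynomial.mkDerivation ℂ (fun φ : Module.Dual ℂ W =>
        (MvPolynomial.C (φ (a + b)) : MvPolynomial (Module.Dual ℂ W) ℂ)) =
        MvPolynomial.mkDerivation ℂ (fun φ : Module.Dual ℂ W => MvPolynomial.C (φ a)) +
        MvPolynomial.mkDerivation ℂ (fun φ : Module.Dual ℂ W => MvPolynomial.C (φ b)) := by
      apply MvPolynomial.derivation_ext
      intro φ
      simp [MvPolynomial.mkDerivation_X]
    have ha' := ha d f hf hX
    have hb' := hb d f hf hX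
    simp only [dirDeriv, evalAt] at ha' hb' ⊢
    rw [h, Derivation.add_apply, map_add, ha', hb', add_zero]
  smul_mem' := by
    intro c a ha d f hf hX
    have h : MvPolynomial.mkDerivation ℂ (fun φ : Module.Dual ℂ W =>
        (MvPolynomial.C (φ (c • a)) : MvPolynomial (Module.Dual ℂ W) ℂ)) =
        c • MvPolynomial.mkDerivation ℂ (fun φ : Module.Dual ℂ W => MvPolynomial.C (φ a)) := by
      apply MvPolynomial.derivation_ext
      intro φ
      simp [MvPolynomial.mkDerivation_X, MvPolynomial.smul_eq_C_mul]
    have ha' := ha d f hf hX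
    simp only [dirDeriv, evalAt] at ha' ⊢
    rw [h, Derivation.smul_apply, MvPolynomial.smul_eval, ha', mul_zero]

end Projective

section Schur

variable (V : Type*) [AddCommGroup V] [Module ℂ V]

/-- The Young symmetrizer on `V^{⊗d}` of a tableau with entries `0, …, d - 1`; the tableau is given
by the position `T j = (row, column)` of each entry `j`. It symmetrizes along the rows of the
tableau and then antisymmetrizes along its columns. -/
def youngSymmetrizer {d : ℕ} (T : Fin d → ℕ × ℕ) : (⨂[ℂ]^d V) →ₗ[ℂ] (⨂[ℂ]^d V) :=
  (∑ τ : Equiv.Perm (Fin d) with ∀ j, (T (τ j)).2 = (T j).2,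
      ((Equiv.Perm.sign τ : ℤ) : ℂ) •
        (PiTensorProduct.reindex ℂ (fun _ : Fin d => V) τ).toLinearMap) ∘ₗ
    (∑ σ : Equiv.Perm (Fin d) with ∀ j, (T (σ j)).1 = (T j).1,
        (PiTensorProduct.reindex ℂ (fun _ : Fin d => V) σ).toLinearMap)

/-- The standard tableau of shape `(2, 1^{k-1})`, filled with `0, …, k` from top to bottom, starting
from the first column: the entries `0, …, k - 1` form the first column, and `k` is the second
entry of the first row. -/
def hookTableau (k : ℕ) (j : Fin (k + 1)) : ℕ × ℕ :=
  if (j : ℕ) < k then (j, 0) else (0, 1)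

/-- The standard inclusion `⋀^k V ⊗ V → V^{⊗(k+1)}`,
`(u₁ ∧ ⋯ ∧ u_k) ⊗ w ↦ ∑_τ sign(τ) u_{τ(1)} ⊗ ⋯ ⊗ u_{τ(k)} ⊗ w`. -/
def wedgeTensorToTensorPower (k : ℕ) : (⋀[ℂ]^k V ⊗[ℂ] V) →ₗ[ℂ] (⨂[ℂ]^(k + 1) V) :=
  (TensorPower.mulEquiv (R := ℂ) (M := V) (n := k) (m := 1)).toLinearMap ∘ₗ
    TensorProduct.map (exteriorPower.toTensorPower ℂ V k)
      (PiTensorProduct.subsingletonEquiv (R := ℂ) (s := fun _ : Fin 1 => V) 0).symm.toLinearMap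

/-- The Schur module `𝕊_{(2,1^{k-1})} V`, i.e. the image of the Young symmetrizer, as a subspace of
`⋀^k V ⊗ V`. -/
def schurModule (k : ℕ) : Submodule ℂ (⋀[ℂ]^k V ⊗[ℂ] V) :=
  (LinearMap.range (youngSymmetrizer V (hookTableau k))).comap (wedgeTensorToTensorPower V k)

instance schurModuleAddCommGroup (k : ℕ) : AddCommGroup (schurModule V k) :=
  Module.addCommMonoidToAddCommGroup ℂ

variable {V}

/-- The tensor `(u₁ ∧ ⋯ ∧ u_k) ⊗ w`. -/
def wedgeTensor {k : ℕ} (u : Fin k → V) (w : V) : ⋀[ℂ]^k V ⊗[ℂ] V :=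
  exteriorPower.ιMulti ℂ k u ⊗ₜ[ℂ] w

theorem wedgeTensorToTensorPower_wedgeTensor {k : ℕ} (u : Fin k → V) (w : V) :
    wedgeTensorToTensorPower V k (wedgeTensor u w) =
      ∑ τ : Equiv.Perm (Fin k), ((Equiv.Perm.sign τ : ℤ) : ℂ) •
        PiTensorProduct.tprod ℂ (Fin.append (fun i => u (τ i)) (fun _ : Fin 1 => w)) := by
  simp only [wedgeTensorToTensorPower, wedgeTensor, LinearMap.comp_apply, TensorProduct.map_tmul,
    exteriorPower.toTensorPower_apply_ιMulti, LinearEquiv.coe_coe,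
    PiTensorProduct.subsingletonEquiv_symm_apply', TensorProduct.sum_tmul, map_sum]
  refine Finset.sum_congr rfl fun τ _ => ?_
  rw [← TensorPower.tprod_mul_tprod, TensorPower.gMul_def, Units.smul_def,
    ← Int.cast_smul_eq_zsmul ℂ, ← TensorProduct.smul_tmul', map_smul]

theorem wedgeTensor_mem_schurModule {k : ℕ} [NeZero k] (u : Fin k → V) :
    wedgeTensor u (u 0) ∈ schurModule V k := by
  rw [schurModule, Submodule.mem_comap, wedgeTensorToTensorPower_wedgeTensor]
  set x : Fin (k + 1) → V := Fin.append u (fun _ : Fin 1 => u 0) with hx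
  have hxc : ∀ i : Fin k, x i.castSucc = u i := fun i => Fin.append_left u _ i
  have hxl : x (Fin.last k) = u 0 := Fin.append_right u (fun _ : Fin 1 => u 0) 0
  set R : Finset (Equiv.Perm (Fin (k + 1))) :=
    Finset.univ.filter fun σ => ∀ j, (hookTableau k (σ j)).1 = (hookTableau k j).1 with hR
  have hrow : ∀ i j, (hookTableau k i).1 = (hookTableau k j).1 → x i = x j := by
    have h0 : ∀ i : Fin k, (i : ℕ) = 0 → u i = u 0 := fun i hi => by
      congr 1
      exact Fin.ext (by simpa using hi)
    intro i j
    refine Fin.lastCases ?_ (fun i => ?_) i <;> refine Fin.lastCases ?_ (fun j => ?_) j <;>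
      simp only [hookTableau, hxc, hxl, Fin.val_last, Fin.val_castSucc, lt_irrefl, Fin.is_lt,
        if_true, if_false] <;> intro h
    · trivial
    · exact (h0 j h.symm).symm
    · exact h0 i h
    · rw [Fin.ext h]
  have hRx : ∀ σ ∈ R, PiTensorProduct.reindex ℂ (fun _ : Fin (k + 1) => V) σ
      (PiTensorProduct.tprod ℂ x) = PiTensorProduct.tprod ℂ x := by
    intro σ hσ
    rw [PiTensorProduct.reindex_tprod]
    congr 1
    funext i
    apply hrow
    have := (Finset.mem_filter.mp hσ).2 (σ.symm i)
    rw [Equiv.apply_symm_apply] at this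
    exact this.symm
  have hcard : ((R.card : ℕ) : ℂ) ≠ 0 := by
    have : (1 : Equiv.Perm (Fin (k + 1))) ∈ R := by simp [hR]
    exact_mod_cast (Finset.card_pos.mpr ⟨_, this⟩).ne'
  refine ⟨((R.card : ℕ) : ℂ)⁻¹ • PiTensorProduct.tprod ℂ x, ?_⟩
  have hRsum : (∑ σ ∈ R, (PiTensorProduct.reindex ℂ (fun _ : Fin (k + 1) => V) σ).toLinearMap)
      (PiTensorProduct.tprod ℂ x) = ((R.card : ℕ) : ℂ) • PiTensorProduct.tprod ℂ x := by
    rw [LinearMap.sum_apply, Nat.cast_smul_eq_nsmul ℂ, ← Finset.sum_const]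
    exact Finset.sum_congr rfl fun σ hσ => hRx σ hσ
  rw [map_smul, youngSymmetrizer, LinearMap.comp_apply, hRsum, map_smul, smul_smul,
    inv_mul_cancel₀ hcard, one_smul, LinearMap.sum_apply]
  have happ : ∀ (τ : Equiv.Perm (Fin k)) (i : Fin k),
      τ.viaFintypeEmbedding Fin.castSuccEmb i.castSucc = (τ i).castSucc := fun τ i =>
    Equiv.Perm.viaFintypeEmbedding_apply_image τ Fin.castSuccEmb i
  have happ_last : ∀ τ : Equiv.Perm (Fin k),
      τ.viaFintypeEmbedding Fin.castSuccEmb (Fin.last k) = Fin.last k := fun τ =>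
    Equiv.Perm.viaFintypeEmbedding_apply_notMem_range τ _ (by
      rintro ⟨i, hi⟩
      exact (Fin.castSucc_lt_last i).ne hi)
  symm
  refine Finset.sum_bij
    (fun (τ : Equiv.Perm (Fin k)) _ => (τ⁻¹).viaFintypeEmbedding Fin.castSuccEmb)
    ?_ ?_ ?_ ?_
  · intro τ _
    refine Finset.mem_filter.mpr ⟨Finset.mem_univ _, fun j => ?_⟩
    refine Fin.lastCases ?_ (fun j => ?_) j
    · rw [happ_last]
    · rw [happ]
      simp [hookTableau]
  · intro τ _ τ' _ h
    refine inv_injective (Equiv.ext fun i => Fin.castSucc_injective _ ?_)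
    rw [← happ, ← happ, h]
  · intro ρ hρ
    have hρ' := (Finset.mem_filter.mp hρ).2
    have hlast : ρ (Fin.last k) = Fin.last k := by
      have := hρ' (Fin.last k)
      revert this
      refine Fin.lastCases (fun _ => rfl) (fun j hj => ?_) (ρ (Fin.last k))
      simp [hookTableau] at hj
    have hne : ∀ i : Fin k, ρ i.castSucc ≠ Fin.last k := fun i hi =>
      (Fin.castSucc_lt_last i).ne (ρ.injective (hi.trans hlast.symm))
    let f : Fin k → Fin k := fun i => (ρ i.castSucc).castPred (hne i)
    have hf : Function.Injective f := fun a b hab => by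
      have := congrArg Fin.castSucc hab
      simp only [f, Fin.castSucc_castPred] at this
      exact Fin.castSucc_injective _ (ρ.injective this)
    refine ⟨(Equiv.ofBijective f (Finite.injective_iff_bijective.mp hf))⁻¹, Finset.mem_univ _, ?_⟩
    rw [inv_inv]
    refine Equiv.ext fun j => Fin.lastCases ?_ (fun j => ?_) j
    · rw [happ_last, hlast]
    · rw [happ, Equiv.ofBijective_apply, Fin.castSucc_castPred]
  · intro τ _
    rw [LinearMap.smul_apply, LinearEquiv.coe_coe, PiTensorProduct.reindex_tprod,
      Equiv.Perm.viaFintypeEmbedding_sign, Equiv.Perm.sign_inv]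
    congr 2
    funext j
    have hinv : ((τ⁻¹).viaFintypeEmbedding Fin.castSuccEmb).symm j =
        τ.viaFintypeEmbedding Fin.castSuccEmb j := by
      rw [Equiv.symm_apply_eq]
      refine Fin.lastCases ?_ (fun j => ?_) j
      · rw [happ_last, happ_last]
      · rw [happ, happ]; simp
    rw [hinv]
    refine Fin.lastCases ?_ (fun j => ?_) j
    · rw [happ_last, hxl]
      exact Fin.append_right _ (fun _ : Fin 1 => u 0) 0
    · rw [happ, hxc]
      exact Fin.append_left _ (fun _ : Fin 1 => u 0) j

theorem wedgeTensor_ne_zero {k : ℕ} (u : Fin k → V) (hu : LinearIndependent ℂ u) (w : V)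
    (hw : w ≠ 0) : wedgeTensor u w ≠ 0 := by
  have h1 : exteriorPower.ιMulti ℂ k u ≠ 0 := by
    have h := (exteriorPower.ιMulti_family_linearIndependent_field (n := k) hu).ne_zero
      (Set.powersetCard.ofFinEmbEquiv (RelEmbedding.refl _))
    rw [exteriorPower.ιMulti_family, Equiv.symm_apply_apply] at h
    exact h
  obtain ⟨φ, hφ⟩ : ∃ φ : Module.Dual ℂ V, φ w ≠ 0 := by
    by_contra! h
    exact hw ((Module.forall_dual_apply_eq_zero_iff ℂ w).mp h)
  intro h
  have h2 := congrArg (TensorProduct.rid ℂ _ ∘ TensorProduct.map LinearMap.id φ) h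
  simp [wedgeTensor, hφ, h1] at h2

/-- A flag `V₁ ⊆ V₂ ⊆ V` with `dim V₁ = 1` and `dim V₂ = k`. -/
structure PartialFlag (V : Type*) [AddCommGroup V] [Module ℂ V] (k : ℕ) where
  line : Submodule ℂ V
  space : Submodule ℂ V
  line_le_space : line ≤ space
  finrank_line : Module.finrank ℂ line = 1
  finrank_space : Module.finrank ℂ space = k

/-- The vectors `u₁, …, u_k` form a basis of `V₂` whose first vector spans `V₁`. -/
structure PartialFlag.IsAdapted {k : ℕ} [NeZero k] (F : PartialFlag V k) (u : Fin k → V) :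
    Prop where
  linearIndependent : LinearIndependent ℂ u
  span_line : Submodule.span ℂ {u 0} = F.line
  span_space : Submodule.span ℂ (Set.range u) = F.space

/-- The point `[u₁ ∧ ⋯ ∧ u_k ⊗ u₁]` of `ℙ(𝕊_{(2,1^{k-1})} V)`, for linearly independent `u`. -/
def flagPoint {k : ℕ} [NeZero k] (u : Fin k → V) (hu : LinearIndependent ℂ u) :
    ℙ ℂ (schurModule V k) :=
  Projectivization.mk ℂ ⟨wedgeTensor u (u 0), wedgeTensor_mem_schurModule u⟩
    fun h => wedgeTensor_ne_zero u hu (u 0) (hu.ne_zero 0) (congrArg Subtype.val h)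

variable (V) in
/-- The flag variety `𝔽(1,k;V)` embedded in `ℙ(𝕊_{(2,1^{k-1})} V)`: the flag `V₁ ⊆ V₂` is sent to
`[u₁ ∧ ⋯ ∧ u_k ⊗ u₁]` for any adapted basis `u` of the flag. -/
def flagVariety (k : ℕ) [NeZero k] : Set (ℙ ℂ (schurModule V k)) :=
  {x | ∃ (F : PartialFlag V k) (u : Fin k → V) (hu : F.IsAdapted u),
    x = flagPoint u hu.linearIndependent}

/-- The first `k` vectors `v₁, …, v_k` of a basis `v₁, …, v_n`. -/
def firstVectors {k n : ℕ} (h : k ≤ n) (v : Module.Basis (Fin n) ℂ V) (i : Fin k) : V :=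
  v (Fin.castLE h i)

theorem linearIndependent_firstVectors {k n : ℕ} (h : k ≤ n) (v : Module.Basis (Fin n) ℂ V) :
    LinearIndependent ℂ (firstVectors h v) :=
  v.linearIndependent.comp _ (Fin.castLE_injective h)

/-- The point `p = [v₁ ∧ ⋯ ∧ v_k ⊗ v₁]` of the highest weight vector, for a basis `v₁, …, v_n`. -/
def highestWeightPoint {k n : ℕ} [NeZero k] (h : k ≤ n) (v : Module.Basis (Fin n) ℂ V) :
    ℙ ℂ (schurModule V k) :=
  flagPoint (firstVectors h v) (linearIndependent_firstVectors h v)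

end Schur

end SchurFlag

end

open scoped TensorProduct
open scoped LinearAlgebra.Projectivization

namespace SchurFlag

/-! ### Calculus of polynomial functions on the cone: curves, linear forms and quadrics. -/

section Projective

variable {W : Type*} [AddCommGroup W] [Module ℂ W]

/-! The two inclusions are proved separately, with no dimension count and no knowledge of the full
ideal of the flag variety.

Every generator is the velocity at `t = 0` of a curve of degree at most two in the affine cone:
rescale the point, move `v_i` to `v_i + t v_h` for `i ≠ 1`, or move `v_1` to `v_1 + t v_h` in both
tensor factors at once (`tangentGenerators_subset`).

Conversely, two families of equations suffice. The linear incidence relations `sum_detForm_update`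
say that `u_1` lies in the span of `u_1, …, u_k`; the quadrics `detForm_mul_detForm` combine the
Plücker and Segre relations. Differentiated at the point, the quadrics kill every coordinate of a
tangent vector with two wedge indices beyond `k`, or with one such index and last factor other than
`v_1` (`detForm_eq_zero_of_mem_tangentCone`). Subtracting generators of the third kind removes the
coordinates of `v_1 ∧ ⋯ ∧ v_k ⊗ v_h`, `h ≠ 1`; incidence then removes those of `v_h ∧ v_2 ∧ ⋯ ∧ v_k
⊗ v_1`, and only generators of the first two kinds remain (`mem_span_of_detForm_eq_zero`). -/

theorem evalAt_C (w : W) (a : ℂ) : evalAt w (MvPolynomial.C a) = a := by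
  simp [evalAt]

theorem evalAt_X (w : W) (φ : Module.Dual ℂ W) : evalAt w (MvPolynomial.X φ) = φ w := by
  simp [evalAt]

theorem evalAt_add (w : W) (f g : MvPolynomial (Module.Dual ℂ W) ℂ) :
    evalAt w (f + g) = evalAt w f + evalAt w g := by
  simp [evalAt]

theorem evalAt_mul (w : W) (f g : MvPolynomial (Module.Dual ℂ W) ℂ) :
    evalAt w (f * g) = evalAt w f * evalAt w g := by
  simp [evalAt]

theorem evalAt_sum {ι : Type*} (s : Finset ι) (w : W)
    (f : ι → MvPolynomial (Module.Dual ℂ W) ℂ) :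
    evalAt w (∑ i ∈ s, f i) = ∑ i ∈ s, evalAt w (f i) := by
  simp [evalAt]

theorem dirDeriv_C (x w : W) (a : ℂ) : dirDeriv x w (MvPolynomial.C a) = 0 := by
  simp [dirDeriv, evalAt]

theorem dirDeriv_X (x w : W) (φ : Module.Dual ℂ W) :
    dirDeriv x w (MvPolynomial.X φ) = φ w := by
  simp [dirDeriv, evalAt, MvPolynomial.mkDerivation_X]

theorem dirDeriv_add (x w : W) (f g : MvPolynomial (Module.Dual ℂ W) ℂ) :
    dirDeriv x w (f + g) = dirDeriv x w f + dirDeriv x w g := by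
  simp [dirDeriv, evalAt]

theorem dirDeriv_sum {ι : Type*} (s : Finset ι) (x w : W)
    (f : ι → MvPolynomial (Module.Dual ℂ W) ℂ) :
    dirDeriv x w (∑ i ∈ s, f i) = ∑ i ∈ s, dirDeriv x w (f i) := by
  simp [dirDeriv, evalAt]

theorem dirDeriv_mul (x w : W) (f g : MvPolynomial (Module.Dual ℂ W) ℂ) :
    dirDeriv x w (f * g) = dirDeriv x w f * evalAt x g + evalAt x f * dirDeriv x w g := by
  simp only [dirDeriv, evalAt, Derivation.leibniz, smul_eq_mul, map_add, map_mul]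
  ring

/-- The directional derivative is the derivative along any parabola with the given velocity. -/
theorem hasDerivAt_evalAt (x w z : W) (f : MvPolynomial (Module.Dual ℂ W) ℂ) :
    HasDerivAt (fun t : ℂ => evalAt (x + t • w + t ^ 2 • z) f) (dirDeriv x w f) 0 := by
  induction f using MvPolynomial.induction_on with
  | C a =>
    simp only [evalAt_C, dirDeriv_C]
    exact hasDerivAt_const _ _
  | add f g hf hg =>
    simp only [evalAt_add, dirDeriv_add]
    exact hf.fun_add hg
  | mul_X f φ hf =>
    have h : HasDerivAt (fun t : ℂ => φ x + t * φ w + t ^ 2 * φ z) (φ w) 0 := by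
      have h1 := (((hasDerivAt_id (0 : ℂ)).mul_const (φ w)).const_add (φ x)).fun_add
        (((hasDerivAt_id (0 : ℂ)).pow 2).mul_const (φ z))
      simpa using h1
    simp only [evalAt_mul, dirDeriv_mul, evalAt_X, dirDeriv_X, map_add, map_smul, smul_eq_mul]
    simpa using hf.fun_mul h

theorem smul_mem_affineCone {X : Set (ℙ ℂ W)} {w : W} (hw : w ∈ affineCone X) (c : ℂ) :
    c • w ∈ affineCone X := by
  intro h
  have hw0 : w ≠ 0 := fun h0 => h (by rw [h0, smul_zero])
  have hc : c ≠ 0 := fun h0 => h (by rw [h0, zero_smul])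
  have := hw hw0
  rwa [(Projectivization.mk_eq_mk_iff' ℂ (c • w) w h hw0).mpr ⟨c, rfl⟩]

/-- The velocity of a parabola in the affine cone is a tangent vector. -/
theorem mem_tangentCone_of_parabola {X : Set (ℙ ℂ W)} {x : W} (hx : x ≠ 0) {w : W} (z : W)
    (h : ∀ t : ℂ, x + t • w + t ^ 2 • z ∈ affineCone X) :
    w ∈ tangentCone X (Projectivization.mk ℂ x hx) := by
  -- The tangent cone is computed at the chosen representative `c • x`, so the whole parabola is
  -- rescaled by `c`.
  obtain ⟨c, hc⟩ := Projectivization.exists_smul_eq_mk_rep ℂ x hx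
  refine ((tangentCone X _).smul_mem_iff c.ne_zero).mp ?_
  intro d f _ hf
  have h1 := hasDerivAt_evalAt (Projectivization.mk ℂ x hx).rep ((c : ℂ) • w) ((c : ℂ) • z) f
  refine h1.unique ?_
  have h2 : ∀ t : ℂ, evalAt ((Projectivization.mk ℂ x hx).rep + t • ((c : ℂ) • w) +
      t ^ 2 • ((c : ℂ) • z)) f = 0 := by
    intro t
    have := hf _ (smul_mem_affineCone (h t) (c : ℂ))
    rw [← hc]
    convert this using 2
    rw [smul_add, smul_add, smul_comm (c : ℂ) t, smul_comm (c : ℂ) (t ^ 2)]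
    rfl
  simp only [h2]
  exact hasDerivAt_const _ _

/-- Linear equations of the cone hold on its tangent spaces. -/
theorem linear_eq_zero_of_mem_tangentCone {X : Set (ℙ ℂ W)} {p : ℙ ℂ W} {w : W}
    (hw : w ∈ tangentCone X p) (φ : Module.Dual ℂ W) (h : ∀ y ∈ affineCone X, φ y = 0) :
    φ w = 0 := by
  have := hw 1 (MvPolynomial.X φ) (MvPolynomial.isHomogeneous_X ℂ φ)
    (by simpa only [evalAt_X] using h)
  rwa [dirDeriv_X] at this

/-- Tangent vectors are annihilated by the differentials of the quadrics through the cone. -/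
theorem quadric_deriv_eq_zero_of_mem_tangentCone {X : Set (ℙ ℂ W)} {x : W} (hx : x ≠ 0) {w : W}
    (hw : w ∈ tangentCone X (Projectivization.mk ℂ x hx)) {ι : Type*} (s : Finset ι)
    (φ ψ : ι → Module.Dual ℂ W) (h : ∀ y ∈ affineCone X, ∑ i ∈ s, φ i y * ψ i y = 0) :
    ∑ i ∈ s, (φ i w * ψ i x + φ i x * ψ i w) = 0 := by
  obtain ⟨c, hc⟩ := Projectivization.exists_smul_eq_mk_rep ℂ x hx
  have h1 := hw 2 (∑ i ∈ s, MvPolynomial.X (φ i) * MvPolynomial.X (ψ i))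
    (MvPolynomial.IsHomogeneous.sum _ _ _ fun i _ =>
      (MvPolynomial.isHomogeneous_X ℂ (φ i)).mul (MvPolynomial.isHomogeneous_X ℂ (ψ i)))
    (by simpa only [evalAt_sum, evalAt_mul, evalAt_X] using h)
  have h2 : ∀ χ : Module.Dual ℂ W, χ (Projectivization.mk ℂ x hx).rep = c * χ x := fun χ => by
    rw [← hc, Units.smul_def, map_smul, smul_eq_mul]
  simp only [dirDeriv_sum, dirDeriv_mul, evalAt_X, dirDeriv_X, h2] at h1
  refine (mul_eq_zero.mp ?_).resolve_left c.ne_zero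
  rw [Finset.mul_sum, ← h1]
  exact Finset.sum_congr rfl fun i _ => by ring

end Projective

/-! ### Coordinates on `⋀^k V ⊗ V` and the equations of the flag variety. -/

section Coordinates

variable {V : Type*} [AddCommGroup V] [Module ℂ V]

/-- A dependent tuple gives the zero tensor, which lies in the cone vacuously. Curves in the cone
therefore need no check of independence at each `t`. -/
theorem wedgeTensor_mem_affineCone {k : ℕ} [NeZero k] (u : Fin k → V) (y : schurModule V k)
    (hy : (y : ⋀[ℂ]^k V ⊗[ℂ] V) = wedgeTensor u (u 0)) : y ∈ affineCone (flagVariety V k) := by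
  intro hy0
  have hu : LinearIndependent ℂ u := by
    by_contra hu
    refine hy0 (Subtype.ext ?_)
    rw [hy, wedgeTensor, AlternatingMap.map_linearDependent _ u hu, TensorProduct.zero_tmul]
    rfl
  refine ⟨⟨Submodule.span ℂ {u 0}, Submodule.span ℂ (Set.range u),
    Submodule.span_mono (Set.singleton_subset_iff.mpr ⟨0, rfl⟩),
    finrank_span_singleton (hu.ne_zero 0), ?_⟩, u, ⟨hu, rfl, rfl⟩, ?_⟩
  · rw [finrank_span_eq_card hu, Fintype.card_fin]
  · rw [flagPoint]
    congr 1
    exact Subtype.ext hy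

/-- Reduces the verification of a homogeneous equation on the cone to decomposable tensors. -/
theorem exists_eq_smul_wedgeTensor {k : ℕ} [NeZero k] {y : schurModule V k}
    (hy : y ∈ affineCone (flagVariety V k)) :
    ∃ (c : ℂ) (u : Fin k → V), (y : ⋀[ℂ]^k V ⊗[ℂ] V) = c • wedgeTensor u (u 0) := by
  by_cases hy0 : y = 0
  · exact ⟨0, 0, by rw [hy0, zero_smul]; rfl⟩
  · obtain ⟨F, u, hu, h⟩ := hy hy0
    rw [flagPoint, Projectivization.mk_eq_mk_iff'] at h
    obtain ⟨c, hc⟩ := h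
    exact ⟨c, u, by rw [← hc]; rfl⟩

/-- The linear form `(u₁ ∧ ⋯ ∧ u_k) ⊗ w ↦ det (φ_j (u_i)) μ(w)`. -/
noncomputable def detForm {k : ℕ} (φ : Fin k → Module.Dual ℂ V) (μ : Module.Dual ℂ V) :
    Module.Dual ℂ (⋀[ℂ]^k V ⊗[ℂ] V) :=
  TensorProduct.dualDistrib ℂ _ _ (exteriorPower.alternatingMapToDual ℂ V k φ ⊗ₜ μ)

theorem detForm_wedgeTensor {k : ℕ} (φ : Fin k → Module.Dual ℂ V) (μ : Module.Dual ℂ V)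
    (u : Fin k → V) (w : V) :
    detForm φ μ (wedgeTensor u w) = (Matrix.of fun i j => φ j (u i)).det * μ w := by
  rw [detForm, wedgeTensor, TensorProduct.dualDistrib_apply,
    exteriorPower.alternatingMapToDual_apply_ιMulti]

theorem detForm_comp_perm {k : ℕ} (φ : Fin k → Module.Dual ℂ V) (μ : Module.Dual ℂ V)
    (σ : Equiv.Perm (Fin k)) :
    detForm (φ ∘ σ) μ = Equiv.Perm.sign σ • detForm φ μ := by
  rw [detForm, AlternatingMap.map_perm, detForm, Units.smul_def, Units.smul_def,
    ← TensorProduct.smul_tmul', map_zsmul]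

theorem detForm_eq_zero {k : ℕ} (φ : Fin k → Module.Dual ℂ V) (μ : Module.Dual ℂ V) {i j : Fin k}
    (h : φ i = φ j) (hij : i ≠ j) : detForm φ μ = 0 := by
  rw [detForm, AlternatingMap.map_eq_zero_of_eq _ φ h hij, TensorProduct.zero_tmul, map_zero]

theorem wedgeTensor_comp_perm {k : ℕ} (u : Fin k → V) (w : V) (σ : Equiv.Perm (Fin k)) :
    wedgeTensor (u ∘ σ) w = ((Equiv.Perm.sign σ : ℤ) : ℂ) • wedgeTensor u w := by
  rw [wedgeTensor, AlternatingMap.map_perm, wedgeTensor, Units.smul_def,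
    ← Int.cast_smul_eq_zsmul ℂ, TensorProduct.smul_tmul']

/-- Exchanging a linear form exchanges a column, which is the shape in which Cramer's rule applies.
-/
theorem of_update_eq_updateCol {k : ℕ} (φ : Fin k → Module.Dual ℂ V) (μ : Module.Dual ℂ V)
    (u : Fin k → V) (j : Fin k) :
    (Matrix.of fun i l => Function.update φ j μ l (u i)) =
      (Matrix.of fun i l => φ l (u i)).updateCol j fun i => μ (u i) := by
  ext i l
  by_cases h : l = j
  · subst h; simp
  · simp [Matrix.updateCol_ne h, Function.update_of_ne h]

/-- Cramer's rule: `u₁` lies in the span of `u₁, …, u_k`. -/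
theorem sum_detForm_update {k : ℕ} (φ : Fin k → Module.Dual ℂ V) (μ : Module.Dual ℂ V)
    (u : Fin k → V) (i : Fin k) :
    ∑ j, detForm (Function.update φ j μ) (φ j) (wedgeTensor u (u i)) =
      detForm φ μ (wedgeTensor u (u i)) := by
  simp only [detForm_wedgeTensor, of_update_eq_updateCol]
  have h := congrFun (Matrix.mulVec_cramer (Matrix.of fun i l => φ l (u i)) fun i => μ (u i)) i
  simp only [Matrix.mulVec, dotProduct, Matrix.cramer_apply, Pi.smul_apply, smul_eq_mul,
    Matrix.of_apply] at h
  rw [← h]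
  exact Finset.sum_congr rfl fun j _ => mul_comm _ _

/-- The Plücker relation that exchanges one vector. -/
theorem detForm_mul_detForm {k : ℕ} (φ ψ : Fin k → Module.Dual ℂ V) (μ ν : Module.Dual ℂ V)
    (a : Fin k) (u : Fin k → V) (w : V) :
    ∑ j, detForm (Function.update φ j (ψ a)) μ (wedgeTensor u w) *
        detForm (Function.update ψ a (φ j)) ν (wedgeTensor u w) =
      detForm φ μ (wedgeTensor u w) * detForm ψ ν (wedgeTensor u w) := by
  simp only [detForm_wedgeTensor, of_update_eq_updateCol]
  set A : Matrix (Fin k) (Fin k) ℂ := Matrix.of fun i l => φ l (u i) with hA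
  set B : Matrix (Fin k) (Fin k) ℂ := Matrix.of fun i l => ψ l (u i) with hB
  have h1 : A.mulVec (A.cramer fun i => ψ a (u i)) =
      ∑ j, (A.updateCol j fun i => ψ a (u i)).det • fun i => φ j (u i) := by
    ext i
    simp only [Matrix.mulVec, dotProduct, Matrix.cramer_apply, Finset.sum_apply, Pi.smul_apply,
      smul_eq_mul]
    exact Finset.sum_congr rfl fun j _ => mul_comm _ _
  -- Cramer's rule for `A` writes `det A` times the column of `ψ a` through the columns of `A`;
  -- substituting both sides for column `a` of `B` and taking determinants gives the exchange
  -- relation.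
  have h2 := congrArg (fun b => B.cramer b a) (h1.symm.trans (Matrix.mulVec_cramer A _))
  have h3 : B.updateCol a (fun i => ψ a (u i)) = B := by
    ext i l
    by_cases h : l = a
    · subst h; simp [hB]
    · simp [Matrix.updateCol_ne h]
  simp only [map_sum, map_smul, Finset.sum_apply, Pi.smul_apply, smul_eq_mul] at h2
  simp only [Matrix.cramer_apply, h3] at h2
  calc _ = (∑ j, (A.updateCol j fun i => ψ a (u i)).det *
        (B.updateCol a fun i => φ j (u i)).det) * (μ w * ν w) := by
        rw [Finset.sum_mul]
        exact Finset.sum_congr rfl fun j _ => by ring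
    _ = _ := by rw [h2]; ring

theorem detForm_wedgeTensor_eq_zero {k : ℕ} {φ : Fin k → Module.Dual ℂ V} (μ : Module.Dual ℂ V)
    {u : Fin k → V} (w : V) (a : Fin k) (h : ∀ i, φ a (u i) = 0) :
    detForm φ μ (wedgeTensor u w) = 0 := by
  rw [detForm_wedgeTensor, Matrix.det_eq_zero_of_column_eq_zero a h, zero_mul]

variable {k : ℕ} [NeZero k]

/-- The tangent vectors at a point satisfy the linear incidence equations of the flag variety. -/
theorem sum_detForm_update_of_mem_tangentCone {p : ℙ ℂ (schurModule V k)} {w : schurModule V k}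
    (hw : w ∈ tangentCone (flagVariety V k) p) (φ : Fin k → Module.Dual ℂ V)
    (μ : Module.Dual ℂ V) :
    ∑ j, detForm (Function.update φ j μ) (φ j) (w : ⋀[ℂ]^k V ⊗[ℂ] V) =
      detForm φ μ (w : ⋀[ℂ]^k V ⊗[ℂ] V) := by
  have h := linear_eq_zero_of_mem_tangentCone hw
    ((∑ j, detForm (Function.update φ j μ) (φ j) - detForm φ μ).comp (schurModule V k).subtype) ?_
  · simpa [sub_eq_zero] using h
  · intro y hy
    obtain ⟨c, u, hu⟩ := exists_eq_smul_wedgeTensor hy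
    rw [LinearMap.comp_apply, Submodule.subtype_apply, hu, map_smul, LinearMap.sub_apply,
      LinearMap.sum_apply, sum_detForm_update, sub_self, smul_zero]

/-- The coordinates of tangent vectors that vanish by the Plücker and Segre equations. -/
theorem detForm_eq_zero_of_mem_tangentCone {u : Fin k → V} (hu : LinearIndependent ℂ u)
    {φ : Fin k → Module.Dual ℂ V} (hφ : ∀ i j, φ j (u i) = if i = j then 1 else 0)
    {w : schurModule V k} (hw : w ∈ tangentCone (flagVariety V k) (flagPoint u hu))
    {ψ : Fin k → Module.Dual ℂ V} {μ : Module.Dual ℂ V} (a : Fin k) (ha : ∀ i, ψ a (u i) = 0)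
    (h : μ (u 0) = 0 ∨ ∃ b ≠ a, ∀ i, ψ b (u i) = 0) :
    detForm ψ μ (w : ⋀[ℂ]^k V ⊗[ℂ] V) = 0 := by
  have hx : detForm φ (φ 0) (wedgeTensor u (u 0)) = 1 := by
    have h1 : (Matrix.of fun i j => φ j (u i)) = 1 := by
      ext i j
      rw [Matrix.of_apply, hφ, Matrix.one_apply]
    rw [detForm_wedgeTensor, h1, Matrix.det_one, hφ, if_pos rfl, one_mul]
  have hψ : ∀ χ, detForm (Function.update ψ a χ) μ (wedgeTensor u (u 0)) = 0 := by
    intro χ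
    rcases h with h | ⟨b, hb, h⟩
    · rw [detForm_wedgeTensor, h, mul_zero]
    · exact detForm_wedgeTensor_eq_zero μ _ b (by simpa [Function.update_of_ne hb] using h)
  have hφa : ∀ j, detForm (Function.update φ j (ψ a)) (φ 0) (wedgeTensor u (u 0)) = 0 := fun j =>
    detForm_wedgeTensor_eq_zero _ _ j (by simpa using ha)
  -- The index `none` carries the product `detForm φ (φ 0) * detForm ψ μ` with a minus sign. At the
  -- point its first factor is `1` and every other factor of the quadric vanishes, so the
  -- differential is `-detForm ψ μ`.
  have key := quadric_deriv_eq_zero_of_mem_tangentCone _ hw (Finset.univ : Finset (Option (Fin k)))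
    (fun j => (j.elim (-detForm φ (φ 0)) fun j => detForm (Function.update φ j (ψ a)) (φ 0)).comp
      (schurModule V k).subtype)
    (fun j => (j.elim (detForm ψ μ) fun j => detForm (Function.update ψ a (φ j)) μ).comp
      (schurModule V k).subtype) ?_
  · simpa [Fintype.sum_option, hx, hψ, hφa, detForm_wedgeTensor_eq_zero μ (u 0) a ha] using key
  · intro y hy
    obtain ⟨c, u, hu⟩ := exists_eq_smul_wedgeTensor hy
    have h2 := detForm_mul_detForm φ ψ (φ 0) μ a u (u 0)
    simp only [Fintype.sum_option, LinearMap.comp_apply, Submodule.subtype_apply, hu, map_smul,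
      smul_eq_mul, Option.elim, LinearMap.neg_apply]
    have h3 : ∀ x y : ℂ, c * x * (c * y) = c ^ 2 * (x * y) := fun x y => by ring
    simp only [h3, ← Finset.mul_sum, h2]
    ring

end Coordinates

/-! ### The tangent space at the highest weight point. -/

section Tangent

variable {V : Type*} [AddCommGroup V] [Module ℂ V] {k n : ℕ}

/-- An injective tuple with at most one entry outside the first `k` indices is, up to order,
obtained from `0, …, k - 1` by replacing one entry. -/
theorem exists_perm_eq_update_castLE [NeZero k] (hkn : k ≤ n) (I : Fin k → Fin n)
    (hI : Function.Injective I) (a : Fin k) (ha : ∀ b, b ≠ a → (I b : ℕ) < k) :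
    ∃ (i : Fin k) (σ : Equiv.Perm (Fin k)), I = Function.update (Fin.castLE hkn) i (I a) ∘ σ := by
  classical
  -- The default `0` can occur only at `b = a`, where the value is overwritten below.
  let g : Fin k → Fin k := fun b => if h : (I b : ℕ) < k then ⟨I b, h⟩ else 0
  have hg : ∀ b, b ≠ a → Fin.castLE hkn (g b) = I b := fun b hb => by
    simp [g, ha b hb]
  -- The other `k - 1` entries cannot fill `Fin k`; the missed index is the one being replaced.
  obtain ⟨i, hi⟩ : ∃ i, i ∉ (Finset.univ.erase a).image g := by
    by_contra! h
    have h1 := Finset.card_le_card (fun i _ => h i : (Finset.univ : Finset (Fin k)) ⊆ _)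
    have h2 := h1.trans Finset.card_image_le
    rw [Finset.card_erase_of_mem (Finset.mem_univ a), Finset.card_univ, Fintype.card_fin] at h2
    have := NeZero.pos k
    omega
  have hi' : ∀ b, b ≠ a → g b ≠ i := fun b hb h =>
    hi (Finset.mem_image.mpr ⟨b, Finset.mem_erase.mpr ⟨hb, Finset.mem_univ b⟩, h⟩)
  have hs : Function.Injective (Function.update g a i) := by
    intro b c h
    by_cases hb : b = a <;> by_cases hc : c = a
    · rw [hb, hc]
    · subst hb
      rw [Function.update_self, Function.update_of_ne hc] at h
      exact absurd h.symm (hi' c hc)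
    · subst hc
      rw [Function.update_self, Function.update_of_ne hb] at h
      exact absurd h (hi' b hb)
    · rw [Function.update_of_ne hb, Function.update_of_ne hc] at h
      exact hI (by rw [← hg b hb, ← hg c hc, h])
  refine ⟨i, Equiv.ofBijective _ (Finite.injective_iff_bijective.mp hs), ?_⟩
  funext b
  by_cases hb : b = a
  · subst hb; simp
  · simp only [Function.comp_apply, Equiv.ofBijective_apply]
    rw [Function.update_of_ne hb, Function.update_of_ne (hi' b hb), hg b hb]

/-- The expansion of a tensor in the basis of `⋀^k V ⊗ V` given by a basis of `V`. -/
theorem eq_sum_detForm_smul_wedgeTensor (v : Module.Basis (Fin n) ℂ V) (w : ⋀[ℂ]^k V ⊗[ℂ] V) :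
    w = ∑ s : Set.powersetCard (Fin n) k × Fin n,
      detForm (v.coord ∘ Set.powersetCard.ofFinEmbEquiv.symm s.1) (v.coord s.2) w •
        wedgeTensor (v ∘ Set.powersetCard.ofFinEmbEquiv.symm s.1) (v s.2) := by
  have h := (((v.exteriorPower k).tensorProduct v).sum_repr w).symm
  refine h.trans (Finset.sum_congr rfl fun s _ => ?_)
  rw [Module.Basis.tensorProduct_apply', exteriorPower.basis_apply]
  congr 1
  rw [← Module.Basis.coord_apply]
  -- The coordinate functional and `detForm` are linear, so they are compared on pure tensors.
  refine LinearMap.congr_fun (TensorProduct.ext' fun x y => ?_) w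
  rw [Module.Basis.coord_apply, Module.Basis.tensorProduct_repr_tmul_apply,
    exteriorPower.basis_repr_apply, detForm, TensorProduct.dualDistrib_apply,
    exteriorPower.ιMultiDual, exteriorPower.ιMulti_family, exteriorPower.pairingDual,
    exteriorPower.alternatingMapLinearEquiv_apply_ιMulti, Module.Basis.coord_apply, smul_eq_mul,
    mul_comm]

/-- The tensors spanning the tangent space at the highest weight point. -/
def tangentGenerators [NeZero k] (hkn : k ≤ n) (v : Module.Basis (Fin n) ℂ V) : Set (⋀[ℂ]^k V ⊗[ℂ] V) :=
  {wedgeTensor (firstVectors hkn v) (firstVectors hkn v 0)} ∪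
    {t | ∃ (i : Fin k) (h : Fin n), i ≠ 0 ∧
      t = wedgeTensor (Function.update (firstVectors hkn v) i (v h)) (firstVectors hkn v 0)} ∪
    {t | ∃ h : Fin n, t = wedgeTensor (firstVectors hkn v) (v h) +
      wedgeTensor (Function.update (firstVectors hkn v) 0 (v h)) (firstVectors hkn v 0)}

theorem highestWeightPoint_mem_flagVariety [NeZero k] (hkn : k ≤ n) (v : Module.Basis (Fin n) ℂ V) :
    highestWeightPoint hkn v ∈ flagVariety V k :=
  wedgeTensor_mem_affineCone (firstVectors hkn v)
    ⟨_, wedgeTensor_mem_schurModule (firstVectors hkn v)⟩ rfl _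

theorem wedgeTensor_update_add_smul (u : Fin k → V) (i : Fin k) (e w : V) (t : ℂ) :
    wedgeTensor (Function.update u i (u i + t • e)) w =
      wedgeTensor u w + t • wedgeTensor (Function.update u i e) w := by
  rw [wedgeTensor, AlternatingMap.map_update_add, AlternatingMap.map_update_smul,
    Function.update_eq_self, TensorProduct.add_tmul, ← TensorProduct.smul_tmul']
  rfl

theorem wedgeTensor_add_smul (u : Fin k → V) (e w : V) (t : ℂ) :
    wedgeTensor u (w + t • e) = wedgeTensor u w + t • wedgeTensor u e := by
  rw [wedgeTensor, TensorProduct.tmul_add, TensorProduct.tmul_smul]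
  rfl

/-- The velocity of a parabola of decomposable tensors is tangent to the flag variety. -/
theorem mem_map_tangentCone_of_parabola [NeZero k] {u : Fin k → V} (hu : LinearIndependent ℂ u)
    {w z : ⋀[ℂ]^k V ⊗[ℂ] V} (hw : w ∈ schurModule V k) (hz : z ∈ schurModule V k)
    (c : ℂ → Fin k → V)
    (h : ∀ t, wedgeTensor (c t) (c t 0) = wedgeTensor u (u 0) + t • w + t ^ 2 • z) :
    w ∈ (tangentCone (flagVariety V k) (flagPoint u hu)).map (schurModule V k).subtype := by
  refine ⟨⟨w, hw⟩, mem_tangentCone_of_parabola _ ⟨z, hz⟩ fun t => ?_, rfl⟩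
  exact wedgeTensor_mem_affineCone (c t) _ (h t).symm

theorem tangentGenerators_subset [NeZero k] (hkn : k ≤ n) (v : Module.Basis (Fin n) ℂ V) :
    tangentGenerators hkn v ⊆
      (tangentCone (flagVariety V k) (highestWeightPoint hkn v)).map
        (schurModule V k).subtype := by
  set u := firstVectors hkn v with hu
  rintro w ((rfl | ⟨i, h, hi, rfl⟩) | ⟨h, rfl⟩)
  -- The curve is the line `(1 + t) • x` through the origin.
  · refine ⟨⟨_, wedgeTensor_mem_schurModule u⟩, mem_tangentCone_of_parabola _ 0 fun t => ?_, rfl⟩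
    rw [smul_zero, add_zero]
    nth_rw 1 [← one_smul ℂ (⟨_, wedgeTensor_mem_schurModule u⟩ : schurModule V k)]
    rw [← add_smul]
    exact smul_mem_affineCone (wedgeTensor_mem_affineCone u _ rfl) _
  · have h0 : ∀ x : V, Function.update u i x 0 = u 0 := fun x => Function.update_of_ne hi.symm _ _
    refine mem_map_tangentCone_of_parabola (z := 0) _ ?_ (zero_mem _)
      (fun t => Function.update u i (u i + t • v h)) fun t => ?_
    · have := wedgeTensor_mem_schurModule (Function.update u i (v h))
      rwa [h0] at this
    · rw [h0, wedgeTensor_update_add_smul, smul_zero, add_zero]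
  · have hz : wedgeTensor (Function.update u 0 (v h)) (v h) ∈ schurModule V k := by
      have := wedgeTensor_mem_schurModule (Function.update u 0 (v h))
      rwa [Function.update_self] at this
    have hc : ∀ t : ℂ, wedgeTensor (Function.update u 0 (u 0 + t • v h)) (u 0 + t • v h) =
        wedgeTensor u (u 0) + t • (wedgeTensor u (v h) +
          wedgeTensor (Function.update u 0 (v h)) (u 0)) +
          t ^ 2 • wedgeTensor (Function.update u 0 (v h)) (v h) := fun t => by
      rw [wedgeTensor_update_add_smul, wedgeTensor_add_smul, wedgeTensor_add_smul]
      module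
    refine mem_map_tangentCone_of_parabola _ ?_ hz
      (fun t => Function.update u 0 (u 0 + t • v h)) fun t => ?_
    -- The velocity is the value of the parabola at `t = 1` minus its constant and quadratic
    -- coefficients, all three in the Schur module.
    · have h1 := wedgeTensor_mem_schurModule (Function.update u 0 (u 0 + (1 : ℂ) • v h))
      rw [Function.update_self, hc] at h1
      have h2 := Submodule.add_mem _ h1 (Submodule.smul_mem _ (-1)
        (Submodule.add_mem _ hz (wedgeTensor_mem_schurModule u)))
      convert h2 using 1
      module
    · rw [Function.update_self, hc]

theorem coord_comp_castLE_firstVectors (hkn : k ≤ n) (v : Module.Basis (Fin n) ℂ V) (i j : Fin k) :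
    (v.coord ∘ Fin.castLE hkn) j (firstVectors hkn v i) = if i = j then 1 else 0 := by
  simp [firstVectors, Finsupp.single_apply]

theorem coord_firstVectors_eq_zero (hkn : k ≤ n) (v : Module.Basis (Fin n) ℂ V) {m : Fin n}
    (i : Fin k) (hm : m ≠ Fin.castLE hkn i) : v.coord m (firstVectors hkn v i) = 0 := by
  simp [firstVectors, hm.symm]

/-- A tangent vector without components `v₁ ∧ ⋯ ∧ v_k ⊗ v_h` for `h ≠ 1` is a combination of the
tangent vectors that fix the line of the flag. -/
theorem mem_span_of_detForm_eq_zero [NeZero k] (hkn : k ≤ n) (v : Module.Basis (Fin n) ℂ V)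
    {w : schurModule V k}
    (hw : w ∈ tangentCone (flagVariety V k) (highestWeightPoint hkn v))
    (h0 : ∀ h : Fin n, h ≠ Fin.castLE hkn 0 →
      detForm (v.coord ∘ Fin.castLE hkn) (v.coord h) (w : ⋀[ℂ]^k V ⊗[ℂ] V) = 0) :
    (w : ⋀[ℂ]^k V ⊗[ℂ] V) ∈ Submodule.span ℂ (tangentGenerators hkn v) := by
  have hvan := fun {ψ μ} => detForm_eq_zero_of_mem_tangentCone (ψ := ψ) (μ := μ)
    (linearIndependent_firstVectors hkn v) (coord_comp_castLE_firstVectors hkn v) hw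
  have hout : ∀ m : Fin n, k ≤ (m : ℕ) → ∀ i, v.coord m (firstVectors hkn v i) = 0 :=
    fun m hm i => coord_firstVectors_eq_zero hkn v i fun h => by
      rw [h, Fin.val_castLE] at hm; exact absurd i.isLt hm.not_gt
  have hupd : ∀ m : Fin n, m ≠ Fin.castLE hkn 0 →
      detForm (Function.update (v.coord ∘ Fin.castLE hkn) 0 (v.coord m))
        (v.coord (Fin.castLE hkn 0)) (w : ⋀[ℂ]^k V ⊗[ℂ] V) = 0 := by
    intro m hm
    by_cases hmk : (m : ℕ) < k
    · have h1 : (⟨m, hmk⟩ : Fin k) ≠ 0 := fun h => hm (by rw [← h]; rfl)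
      rw [detForm_eq_zero _ _ (i := 0) (j := ⟨m, hmk⟩) ?_ h1.symm, LinearMap.zero_apply]
      rw [Function.update_self, Function.update_of_ne h1]
      rfl
    · have h1 := sum_detForm_update_of_mem_tangentCone hw (v.coord ∘ Fin.castLE hkn) (v.coord m)
      -- In the incidence relation the right side is zero by `h0`, and the quadrics kill the terms
      -- `j ≠ 0`, whose last form vanishes on `v_1`.
      rw [h0 m hm, Finset.sum_eq_single 0] at h1
      · exact h1
      · intro j _ hj
        refine hvan j ?_ (Or.inl ?_)
        · rw [Function.update_self]
          exact hout m (not_lt.mp hmk)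
        · rw [coord_comp_castLE_firstVectors, if_neg hj.symm]
      · simp
  rw [eq_sum_detForm_smul_wedgeTensor v (w : ⋀[ℂ]^k V ⊗[ℂ] V)]
  refine Submodule.sum_mem _ fun s _ => ?_
  obtain ⟨s, j⟩ := s
  dsimp only
  have hI : Function.Injective (Set.powersetCard.ofFinEmbEquiv.symm s) :=
    (Set.powersetCard.ofFinEmbEquiv.symm s).injective
  generalize (⇑(Set.powersetCard.ofFinEmbEquiv.symm s) : Fin k → Fin n) = I at hI
  by_cases hc : detForm (v.coord ∘ I) (v.coord j) (w : ⋀[ℂ]^k V ⊗[ℂ] V) = 0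
  · rw [hc, zero_smul]
    exact zero_mem _
  refine Submodule.smul_mem _ _ ?_
  -- Two indices outside the first `k` would make the coordinate vanish by the quadrics.
  obtain ⟨a, ha⟩ : ∃ a, ∀ b, b ≠ a → (I b : ℕ) < k := by
    by_contra! h
    obtain ⟨a, -, ha⟩ := h 0
    obtain ⟨b, hb, hb'⟩ := h a
    exact hc (hvan a (hout _ ha) (Or.inr ⟨b, hb, hout _ hb'⟩))
  obtain ⟨i, σ, hσ⟩ := exists_perm_eq_update_castLE hkn I hI a ha
  generalize I a = m at hσ
  have hcσ : detForm (Function.update (v.coord ∘ Fin.castLE hkn) i (v.coord m)) (v.coord j)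
      (w : ⋀[ℂ]^k V ⊗[ℂ] V) ≠ 0 := by
    intro h
    refine hc ?_
    rw [hσ, ← Function.comp_assoc, detForm_comp_perm, Function.comp_update, LinearMap.smul_apply,
      h, smul_zero]
  have hvσ : v ∘ I = Function.update (firstVectors hkn v) i (v m) ∘ σ := by
    rw [hσ, ← Function.comp_assoc, Function.comp_update]
    rfl
  rw [hvσ, wedgeTensor_comp_perm]
  refine Submodule.smul_mem _ _ ?_
  -- For another last factor the coordinate vanishes: by `h0` if `m` restores the original wedge, by
  -- a repeated form if `m` is another of the first `k` indices, and by the quadrics if `m` lies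
  -- beyond them.
  have hj : j = Fin.castLE hkn 0 := by
    by_contra hj
    refine hcσ ?_
    by_cases hmk : (m : ℕ) < k
    · by_cases him : (⟨m, hmk⟩ : Fin k) = i
      · have hE : Function.update (v.coord ∘ Fin.castLE hkn) i (v.coord m) =
            v.coord ∘ Fin.castLE hkn := by
          rw [Function.update_eq_self_iff, ← him]
          rfl
        rw [hE, h0 j hj]
      · rw [detForm_eq_zero _ _ (i := i) (j := ⟨m, hmk⟩) ?_ (Ne.symm him), LinearMap.zero_apply]
        rw [Function.update_self, Function.update_of_ne him]
        rfl
    · refine hvan i ?_ (Or.inl (coord_firstVectors_eq_zero hkn v 0 hj))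
      rw [Function.update_self]
      exact hout m (not_lt.mp hmk)
  subst hj
  by_cases hi : i = 0
  · subst hi
    have hm : m = Fin.castLE hkn 0 := by
      by_contra hm
      exact hcσ (hupd m hm)
    refine Submodule.subset_span (Or.inl (Or.inl ?_))
    rw [hm, Set.mem_singleton_iff]
    exact congrArg₂ _ (Function.update_eq_self 0 (firstVectors hkn v)) rfl
  · exact Submodule.subset_span (Or.inl (Or.inr ⟨i, m, hi, rfl⟩))

/-- Generators of the third kind are themselves tangent, so subtracting them keeps a vector tangent
and brings it to the normalized case. -/
theorem map_tangentCone_le_span [NeZero k] (hkn : k ≤ n) (v : Module.Basis (Fin n) ℂ V) :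
    (tangentCone (flagVariety V k) (highestWeightPoint hkn v)).map (schurModule V k).subtype ≤
      Submodule.span ℂ (tangentGenerators hkn v) := by
  classical
  intro w hw
  have hg : ∀ h : Fin n, wedgeTensor (firstVectors hkn v) (v h) +
      wedgeTensor (Function.update (firstVectors hkn v) 0 (v h)) (firstVectors hkn v 0) ∈
      tangentGenerators hkn v := fun h => Or.inr ⟨h, rfl⟩
  set S := (Finset.univ : Finset (Fin n)).erase (Fin.castLE hkn 0) with hS
  set g := fun h : Fin n => wedgeTensor (firstVectors hkn v) (v h) +
      wedgeTensor (Function.update (firstVectors hkn v) 0 (v h)) (firstVectors hkn v 0) with hgdef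
  set E := v.coord ∘ Fin.castLE hkn with hE
  -- The second summand of `g h` ends in `⊗ v_1`, which `v.coord m` kills; hence the coordinates to
  -- be removed are dual to the `g h`.
  have hdual : ∀ h ∈ S, ∀ m, m ≠ Fin.castLE hkn 0 →
      detForm E (v.coord m) (g h) = if h = m then 1 else 0 := by
    intro h _ m hm
    have h1 : (Matrix.of fun i j => E j (firstVectors hkn v i)) = 1 := by
      ext i j
      rw [Matrix.of_apply, coord_comp_castLE_firstVectors, Matrix.one_apply]
    rw [hgdef, map_add, detForm_wedgeTensor, detForm_wedgeTensor,
      coord_firstVectors_eq_zero hkn v 0 hm, h1, Matrix.det_one, mul_zero, add_zero, one_mul,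
      Module.Basis.coord_apply, Module.Basis.repr_self, Finsupp.single_apply]
  have hsum : ∑ h ∈ S, detForm E (v.coord h) w • g h ∈
      Submodule.span ℂ (tangentGenerators hkn v) :=
    Submodule.sum_mem _ fun h _ => Submodule.smul_mem _ _ (Submodule.subset_span (hg h))
  obtain ⟨y, hy, hyw⟩ := Submodule.add_mem _ hw (Submodule.smul_mem _ (-1)
    (Submodule.span_le.mpr (tangentGenerators_subset hkn v) hsum))
  have hwy : w = (schurModule V k).subtype y + ∑ h ∈ S, detForm E (v.coord h) w • g h := by
    rw [hyw]
    module
  rw [hwy]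
  refine Submodule.add_mem _ ?_ hsum
  refine mem_span_of_detForm_eq_zero hkn v hy fun m hm => ?_
  have hmS : m ∈ S := Finset.mem_erase.mpr ⟨hm, Finset.mem_univ m⟩
  change detForm E (v.coord m) ((schurModule V k).subtype y) = 0
  rw [hyw, map_add, map_smul, map_sum, Finset.sum_congr rfl fun h hh => by
    rw [map_smul, hdual h hh m hm]]
  simp [hmS]

end Tangent

end SchurFlag

theorem mainTheorem10 (k n : ℕ) [NeZero k] (hkn : k < n)
    (v : Module.Basis (Fin n) ℂ (Fin n → ℂ)) :
    SchurFlag.highestWeightPoint hkn.le v ∈ SchurFlag.flagVariety (Fin n → ℂ) k ∧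
      (SchurFlag.tangentCone (SchurFlag.flagVariety (Fin n → ℂ) k)
          (SchurFlag.highestWeightPoint hkn.le v)).map
            (SchurFlag.schurModule (Fin n → ℂ) k).subtype =
        Submodule.span ℂ
          ({SchurFlag.wedgeTensor (SchurFlag.firstVectors hkn.le v)
              (SchurFlag.firstVectors hkn.le v 0)} ∪
            {t | ∃ (i : Fin k) (h : Fin n), i ≠ 0 ∧
              t = SchurFlag.wedgeTensor
                (Function.update (SchurFlag.firstVectors hkn.le v) i (v h))
                (SchurFlag.firstVectors hkn.le v 0)} ∪
            {t | ∃ h : Fin n,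
              t = SchurFlag.wedgeTensor (SchurFlag.firstVectors hkn.le v) (v h) +
                SchurFlag.wedgeTensor
                  (Function.update (SchurFlag.firstVectors hkn.le v) 0 (v h))
                  (SchurFlag.firstVectors hkn.le v 0)}) :=
  ⟨SchurFlag.highestWeightPoint_mem_flagVariety hkn.le v,
    (SchurFlag.map_tangentCone_le_span hkn.le v).antisymm
      (Submodule.span_le.mpr (SchurFlag.tangentGenerators_subset hkn.le v))⟩
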